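/- Let $n\ge 1$, let $\mathcal P_n$ be the complex vector space of all complex polynomials of degree at most $n$, and let $D$ be differentiation on $\mathcal P_n$. For $f\in\mathcal P_n$, $f\ne0$, let $Z(f)$ be the multiset of the roots of $f$, counted with multiplicity (only the underlying set matters for $d_h$ and $d_H$), and let $Z(0)=\mathbb C$. For nonempty finite $A,B\subset\mathbb C$ put $$d_h(A,B)=\max_{y\in B}\min_{x\in A}|x-y|,\qquad d_H(A,B)=\max\{d_h(A,B),d_h(B,A)\},$$ with $d_h(\emptyset,\emptyset)=0$, $d_h(A,\emptyset)=d_h(\emptyset,A)=+\infty$ for $A\neq\emptyset$, and $d_h(A,B)=0$ if $A,B$ are nonempty and one of them is $\mathbb C$ (and $d_H$ extended by the same formula). For multisets $U=\{u_1,\dots,u_m\}$, $V=\{v_1,\dots,v_m\}$ of $m\ge1$ complex numbers put $$d_F(U,V)=\min_{\sigma}\max_{1\le k\le m}|u_k-v_{\sigma(k)}|,$$ where $\sigma$ runs over the permutations of $\{1,\dots,m\}$. For a linear operator $T:\mathcal P_n\to\mathcal P_n$ let $$K_h(T)=\sup_{f\in\mathcal P_n}d_h(Z(f),Z(Tf)),\qquad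 K_H(T)=\sup_{f\in\mathcal P_n}d_H(Z(f),Z(Tf)),$$ and, if $\deg(Tf)=\deg(f)$ for all $f\in\mathcal P_n$, let $K_F(T)=\sup d_F(Z(f),Z(Tf))$, where the supremum is over all non-constant $f\in\mathcal P_n$. **Theorem.** Let $a_0,\dots,a_n\in\mathbb C$ with $a_0\ne0$, let $T=a_0I+a_1D+\dots+a_nD^n$ on $\mathcal P_n$, and let $\gamma_1,\dots,\gamma_n$ be the roots of $a_0z^n+a_1z^{n-1}+\dots+a_n$, counted with multiplicity. Then $T$ is invertible and $$K_h(T)\le n\sum_{j=1}^n|\gamma_j|,\qquad K_H(T)\le n\sum_{j=1}^n|\gamma_j|.$$ Moreover $\deg(Tf)=\deg(f)$ for all $f\in\mathcal P_n$, so that $K_F(T)$ is defined, and $$K_F(T)\le n^2\sum_{j=1}^n|\gamma_j|.$$ -/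

import Mathlib

open scoped ENNReal Polynomial

namespace RootDistance

/-- The complex vector space of all complex polynomials of degree at most `n`. -/
noncomputable abbrev Pn (n : ℕ) : Submodule ℂ ℂ[X] := Polynomial.degreeLE ℂ (n : WithBot ℕ)

theorem derivative_mem_Pn {n : ℕ} : ∀ f ∈ Pn n, Polynomial.derivative f ∈ Pn n := by
  intro f hf
  rw [Polynomial.mem_degreeLE] at hf ⊢
  exact Polynomial.degree_derivative_le.trans hf

/-- The operator of differentiation on the space of polynomials of degree at most `n`. -/
noncomputable def D (n : ℕ) : Module.End ℂ (Pn n) :=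
  (Polynomial.derivative : ℂ[X] →ₗ[ℂ] ℂ[X]).restrict derivative_mem_Pn

/-- The operator `a₀ I + a₁ D + ⋯ + aₙ Dⁿ`. -/
noncomputable def diffOp {n : ℕ} (a : Fin (n + 1) → ℂ) : Module.End ℂ (Pn n) :=
  ∑ k : Fin (n + 1), a k • D n ^ (k : ℕ)

/-- The polynomial `a₀ zⁿ + a₁ zⁿ⁻¹ + ⋯ + aₙ`. -/
noncomputable def symbol {n : ℕ} (a : Fin (n + 1) → ℂ) : ℂ[X] :=
  ∑ k : Fin (n + 1), Polynomial.C (a k) * Polynomial.X ^ (n - (k : ℕ))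

/-- The set of roots of `f`; it is the whole plane for `f = 0`. -/
def Z (f : ℂ[X]) : Set ℂ := {z | f.IsRoot z}

open Classical in
/-- The distance of two closest points. The infimum is a minimum when `A` and `B` are finite and
nonempty, and it is `+∞` if exactly one of the two sets is empty. -/
noncomputable def dm (A B : Set ℂ) : ℝ≥0∞ :=
  if A = ∅ ∧ B = ∅ then 0 else ⨅ x ∈ A, ⨅ y ∈ B, edist x y

open Classical in
/-- The asymmetric Hausdorff distance `max {d_m(A, {y}) : y ∈ B}`, extended to the empty set
(value `0` if both sets are empty, `+∞` if exactly one of them is) and to the whole plane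
(value `0` if one of the sets is the plane and the other is nonempty). -/
noncomputable def dh (A B : Set ℂ) : ℝ≥0∞ :=
  if B = ∅ then (if A = ∅ then 0 else ⊤)
  else if A ≠ ∅ ∧ B = Set.univ then 0
  else ⨆ y ∈ B, dm A {y}

/-- The Hausdorff distance. -/
noncomputable def dH (A B : Set ℂ) : ℝ≥0∞ := max (dh A B) (dh B A)

/-- The Fréchet distance of two multisets with the same number of elements: the minimum over all
bijections `σ` from the elements of `U` to those of `V` (elements counted with multiplicity) of
the largest distance between an element and its partner. -/
noncomputable def dF (U V : Multiset ℂ) : ℝ≥0∞ :=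
  ⨅ σ : U.ToType ≃ V.ToType, ⨆ x : U.ToType, edist x.1 (σ x).1

/-- `K_h(T)`, the supremum of `d_h(Z(f), Z(Tf))`. -/
noncomputable def Kh {n : ℕ} (T : Module.End ℂ (Pn n)) : ℝ≥0∞ :=
  ⨆ f : Pn n, dh (Z (f : ℂ[X])) (Z (T f : ℂ[X]))

/-- `K_H(T)`, the supremum of `d_H(Z(f), Z(Tf))`. -/
noncomputable def KH {n : ℕ} (T : Module.End ℂ (Pn n)) : ℝ≥0∞ :=
  ⨆ f : Pn n, dH (Z (f : ℂ[X])) (Z (T f : ℂ[X]))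

/-- `deg (Tf) = deg f` for all `f`. -/
def PreservesDegree {n : ℕ} (T : Module.End ℂ (Pn n)) : Prop :=
  ∀ f : Pn n, (T f : ℂ[X]).degree = (f : ℂ[X]).degree

/-- `K_F(T)`, the supremum of `d_F(Z(f), Z(Tf))` over all non-constant `f`, where roots are counted
with multiplicity; it is defined only for operators that preserve degrees. -/
noncomputable def KF {n : ℕ} (T : Module.End ℂ (Pn n)) (_hT : PreservesDegree T) : ℝ≥0∞ :=
  ⨆ f : Pn n, ⨆ _ : 0 < (f : ℂ[X]).natDegree, dF (f : ℂ[X]).roots (T f : ℂ[X]).roots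

end RootDistance

namespace RootDistance

/-! Reversing the symbol gives `T = a₀ ∏ (1 - γⱼ D)`, so everything reduces to comparing the zeros
of `f` with those of `g = f - γ f'`; the bounds for the factors then add up. Put `m = deg f` and `r
= m|γ|`.

A zero of `g` is within `r` of a root of `f`: unless it is itself a root, it satisfies `∑ γ/(z - x)
= 1` over the `m` roots `x`, so some term has modulus at least `1/m`. Conversely, every zero of `f -
tγ f'` with `0 ≤ t ≤ 1` is within `r` of a zero of `g` (`exists_zero_near_of_sub_derivative`).
Indeed `1 - tγD` is `1 - γD` times a power series in `γD`, so after translation a zero at `0` says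
that `g` is apolar to an explicit polynomial `q`. Eneström–Kakeya puts the zeros of `q` in the disc
of radius `r`, and Grace's theorem yields a zero of `g` there. The case `t = 0` gives the other half
of the Hausdorff bound.

For the Fréchet bound, Hall's theorem reduces the matching within `m r` to excluding sets `A` of
roots of `f` and `B` of roots of `g` with `|A| + |B| > m` and all mutual distances above `m r`.
Along the path `f - tγ f'` the roots stay within `r` of those of `f`, and also of those of `g`.
Clusters of discs therefore keep their number of roots, and starting the path from the larger of `A`
and `B` gives a close pair (`exists_close_roots`). -/

open Polynomial

/-! ### Logarithmic derivative estimate -/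

/-- A zero of `f - γ f'` is close to a root of `f`. -/
theorem exists_root_near_of_sub_derivative {f : ℂ[X]} (hf : f ≠ 0) {γ z : ℂ}
    (h : (f - C γ * derivative f).eval z = 0) :
    ∃ x ∈ f.roots, ‖z - x‖ ≤ f.natDegree * ‖γ‖ := by
  by_contra! hne
  have hz : f.eval z ≠ 0 := by
    intro h0
    have := hne z ((mem_roots hf).2 h0)
    rw [sub_self, norm_zero] at this
    exact absurd this (not_lt.2 (by positivity))
  have hlog := (IsAlgClosed.splits f).eval_derivative_div_eval_of_ne_zero hz
  have hone : (f.roots.map fun x ↦ γ * (1 / (z - x))).sum = 1 := by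
    rw [Multiset.sum_map_mul_left, ← hlog]
    simp only [eval_sub, eval_mul, eval_C] at h
    field_simp
    linear_combination -h
  have hcard : f.roots.card = f.natDegree := (IsAlgClosed.splits f).natDegree_eq_card_roots.symm
  have hs : f.roots ≠ ∅ := by
    intro h0
    rw [h0] at hone
    simp at hone
  have hm : (0 : ℝ) < f.natDegree := by
    rw [← hcard]
    exact_mod_cast Multiset.card_pos.2 hs
  have hlt : (f.roots.map fun x ↦ ‖γ * (1 / (z - x))‖).sum <
      (f.roots.map fun _ ↦ 1 / (f.natDegree : ℝ)).sum := by
    refine Multiset.sum_lt_sum_of_nonempty hs fun x hx ↦ ?_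
    have h1 := hne x hx
    have h2 : 0 < ‖z - x‖ := lt_of_le_of_lt (by positivity) h1
    rw [norm_mul, norm_div, norm_one, mul_one_div, div_lt_div_iff₀ h2 hm]
    linarith
  have hle := norm_multiset_sum_le (f.roots.map fun x ↦ γ * (1 / (z - x)))
  rw [hone, norm_one, Multiset.map_map] at hle
  simp only [Function.comp_def] at hle
  have : (f.roots.map fun _ ↦ 1 / (f.natDegree : ℝ)).sum = 1 := by
    simp [hcard, hm.ne']
  linarith

/-! ### Laguerre's theorem -/

/-- Averages, possibly padded with zeros, stay in a convex set containing zero. -/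
theorem sum_div_mem_of_convex {Ω : Set ℂ} (hΩ : Convex ℝ Ω) (h0 : (0 : ℂ) ∈ Ω) (t : Multiset ℂ) :
    (∀ s ∈ t, s ∈ Ω) → ∀ N : ℝ, 0 < N → (t.card : ℝ) ≤ N → t.sum / (N : ℂ) ∈ Ω := by
  induction t using Multiset.induction with
  | empty => intro _ N _ _; simpa using h0
  | cons a t ih =>
    intro ht N hN hc
    have ha : a ∈ Ω := ht a (Multiset.mem_cons_self a t)
    have ht' : ∀ s ∈ t, s ∈ Ω := fun s hs ↦ ht s (Multiset.mem_cons_of_mem hs)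
    rw [Multiset.card_cons, Nat.cast_add, Nat.cast_one] at hc
    rcases (show 1 ≤ N from le_trans (by linarith [Nat.cast_nonneg (α := ℝ) t.card]) hc).eq_or_lt
      with h1 | h1
    · have : t = 0 := by
        have : (t.card : ℝ) ≤ 0 := by linarith
        exact Multiset.card_eq_zero.1 (Nat.le_zero.1 (by exact_mod_cast this))
      simpa [this, ← h1] using ha
    -- The new average is `(1/N) a + ((N-1)/N)` times the old one taken with weight `N - 1`; this
    -- needs `N ≠ 1`.
    · have hm := ih ht' (N - 1) (by linarith) (by linarith)
      have hc := hΩ ha hm (show 0 ≤ 1 / N by positivity)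
        (show 0 ≤ (N - 1) / N from div_nonneg (by linarith) hN.le) (by field_simp; ring)
      have hN' : (N : ℂ) ≠ 0 := by exact_mod_cast hN.ne'
      have hN1 : (N : ℂ) - 1 ≠ 0 := by
        have : N - 1 ≠ 0 := by linarith
        exact_mod_cast this
      convert hc using 1
      simp only [Complex.real_smul, Multiset.sum_cons]
      push_cast
      field_simp

/-- Inversion at a point `z` of a disc maps the complement of the disc to a convex set. -/
theorem convex_inversion {r : ℝ} {z : ℂ} (hz : ‖z‖ ≤ r) :
    Convex ℝ {s : ℂ | 0 < Complex.normSq (1 + z * s) - r ^ 2 * Complex.normSq s} := by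
  have hz2 : Complex.normSq z ≤ r ^ 2 := by
    rw [Complex.normSq_eq_norm_sq]
    exact pow_le_pow_left₀ (norm_nonneg z) hz 2
  intro x hx y hy a b ha hb hab
  simp only [Set.mem_ofPred_eq] at hx hy ⊢
  obtain rfl : b = 1 - a := by linarith
  -- The quadratic part of the defining function is `(|z|² - r²)|s|²`, with nonpositive coefficient,
  -- so the function is concave and its positivity set convex.
  have key : Complex.normSq (1 + z * (a • x + (1 - a) • y)) -
      r ^ 2 * Complex.normSq (a • x + (1 - a) • y) =
      a * (Complex.normSq (1 + z * x) - r ^ 2 * Complex.normSq x) +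
      (1 - a) * (Complex.normSq (1 + z * y) - r ^ 2 * Complex.normSq y) +
      a * (1 - a) * ((r ^ 2 - Complex.normSq z) * Complex.normSq (x - y)) := by
    simp only [Complex.normSq_apply, Complex.add_re, Complex.add_im, Complex.mul_re,
      Complex.mul_im, Complex.real_smul, Complex.ofReal_re, Complex.ofReal_im, Complex.one_re,
      Complex.one_im, Complex.sub_re, Complex.sub_im]
    ring
  rw [key]
  have h3 : 0 ≤ a * (1 - a) * ((r ^ 2 - Complex.normSq z) * Complex.normSq (x - y)) :=
    mul_nonneg (mul_nonneg ha hb) (mul_nonneg (by linarith) (Complex.normSq_nonneg _))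
  have h4 : 0 < a * (Complex.normSq (1 + z * x) - r ^ 2 * Complex.normSq x) +
      (1 - a) * (Complex.normSq (1 + z * y) - r ^ 2 * Complex.normSq y) := by
    rcases ha.eq_or_lt with h | h
    · rw [← h]; simpa using hy
    · exact add_pos_of_pos_of_nonneg (mul_pos h hx) (mul_nonneg hb hy.le)
  linarith

theorem inversion_identity (r : ℝ) (z : ℂ) {w : ℂ} (hw : w ≠ 0) :
    Complex.normSq (1 + z * w⁻¹) - r ^ 2 * Complex.normSq w⁻¹ =
      (‖w + z‖ ^ 2 - r ^ 2) * Complex.normSq w⁻¹ := by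
  have : 1 + z * w⁻¹ = (w + z) * w⁻¹ := by field_simp
  rw [this, Complex.normSq_mul, Complex.normSq_eq_norm_sq (w + z)]
  ring

/-- **Laguerre's theorem**: the polar derivative, with pole in a disc, of a polynomial without
zeros in that disc has no zeros in the disc. -/
theorem polarDerivative_eval_ne_zero {r : ℝ} {g : ℂ[X]} {N : ℕ} (hN : 0 < N)
    (hdeg : g.natDegree ≤ N) (hg : ∀ w, ‖w‖ ≤ r → g.eval w ≠ 0) {v z : ℂ} (hv : ‖v‖ ≤ r)
    (hz : ‖z‖ ≤ r) : (C (N : ℂ) * g - (X - C v) * derivative g).eval z ≠ 0 := by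
  intro h
  have hgz := hg z hz
  have hr : 0 ≤ r := (norm_nonneg z).trans hz
  have hN' : (N : ℂ) ≠ 0 := by exact_mod_cast hN.ne'
  have hlog := (IsAlgClosed.splits g).eval_derivative_div_eval_of_ne_zero hgz
  simp only [eval_sub, eval_mul, eval_C, eval_X] at h
  have hvz : v - z ≠ 0 := by
    intro h0
    have : z - v = 0 := by linear_combination -h0
    rw [this, zero_mul, sub_zero] at h
    exact (mul_ne_zero hN' hgz) h
  have hg0 : g ≠ 0 := by rintro rfl; simp at hgz
  -- The missing `N - deg g` roots count as roots at infinity, which inversion sends to `0`.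
  have hmem := sum_div_mem_of_convex (convex_inversion hz) (by simp)
    (g.roots.map fun y ↦ (y - z)⁻¹) (by
      intro s hs
      obtain ⟨y, hy, rfl⟩ := Multiset.mem_map.1 hs
      have hyr : r < ‖y‖ := by
        by_contra! hle
        exact hg y hle ((mem_roots hg0).1 hy)
      have hyz : y - z ≠ 0 := by
        intro h0
        rw [sub_eq_zero.1 h0] at hyr
        exact absurd hz (not_le.2 hyr)
      rw [Set.mem_ofPred_eq, inversion_identity r z hyz, sub_add_cancel]
      refine mul_pos ?_ (Complex.normSq_pos.2 (inv_ne_zero hyz))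
      nlinarith) N (by exact_mod_cast hN) (by
      rw [Multiset.card_map]
      exact_mod_cast (card_roots' g).trans hdeg)
  -- Vanishing of the polar derivative makes the pole `v` the centre of mass of the roots as seen
  -- from `z`, which forces `v` out of the disc.
  have hsum : (g.roots.map fun y ↦ (y - z)⁻¹).sum / ((N : ℝ) : ℂ) = (v - z)⁻¹ := by
    have h1 : (g.roots.map fun y ↦ (y - z)⁻¹).sum = -(eval z (derivative g) / eval z g) := by
      rw [hlog, ← Multiset.sum_map_neg', Multiset.map_map]
      refine congrArg Multiset.sum (Multiset.map_congr rfl fun y _ ↦ ?_)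
      rw [Function.comp_apply, one_div, ← inv_neg, neg_sub]
    rw [h1, Complex.ofReal_natCast]
    field_simp
    linear_combination -h
  rw [hsum, Set.mem_ofPred_eq, inversion_identity r z hvz, sub_add_cancel] at hmem
  have : (‖v‖ ^ 2 - r ^ 2) * Complex.normSq (v - z)⁻¹ ≤ 0 :=
    mul_nonpos_of_nonpos_of_nonneg (by nlinarith [norm_nonneg v]) (Complex.normSq_nonneg _)
  linarith

/-! ### Apolarity and Grace's theorem -/

theorem iterate_derivative_X_sub_C_mul (v : ℂ) (p : ℂ[X]) (j : ℕ) :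
    derivative^[j] ((X - C v) * p) =
      (X - C v) * derivative^[j] p + C (j : ℂ) * derivative^[j - 1] p := by
  induction j with
  | zero => simp
  | succ j ih =>
    rw [Function.iterate_succ_apply', ih, Function.iterate_succ_apply' _ j p]
    cases j with
    | zero => simp; ring
    | succ j =>
      simp only [Nat.add_sub_cancel, derivative_add, derivative_mul, derivative_sub, derivative_X,
        derivative_C, Function.iterate_succ_apply']
      push_cast
      simp only [C_add, C_1]
      ring

/-- The apolar pairing of polynomials of degree at most `m`. -/
noncomputable def apolar (m : ℕ) (g q : ℂ[X]) : ℂ :=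
  ∑ k ∈ Finset.range (m + 1),
    (-1) ^ k * (derivative^[k] g).eval 0 * (derivative^[m - k] q).eval 0

/-- The induction step of Grace's theorem: splitting a linear factor off one argument takes the
polar derivative of the other, and Laguerre's theorem keeps the latter free of zeros in the disc. -/
theorem apolar_X_sub_C_mul {m : ℕ} (g : ℂ[X]) {q : ℂ[X]} (hq : q.natDegree ≤ m) (v : ℂ) :
    apolar (m + 1) g ((X - C v) * q) =
      apolar m (C ((m + 1 : ℕ) : ℂ) * g - (X - C v) * derivative g) q := by
  have hlast : derivative^[m + 1] q = 0 := iterate_derivative_eq_zero (by omega)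
  have hL : apolar (m + 1) g ((X - C v) * q) =
      ∑ k ∈ Finset.range (m + 2), (-1) ^ k * (derivative^[k] g).eval 0 *
        (-v * (derivative^[m + 1 - k] q).eval 0) +
      ∑ k ∈ Finset.range (m + 2), (-1) ^ k * (derivative^[k] g).eval 0 *
        (((m + 1 - k : ℕ) : ℂ) * (derivative^[m - k] q).eval 0) := by
    rw [apolar, ← Finset.sum_add_distrib]
    refine Finset.sum_congr rfl fun k _ ↦ ?_
    rw [iterate_derivative_X_sub_C_mul, show m + 1 - k - 1 = m - k by omega]
    simp only [eval_add, eval_mul, eval_sub, eval_X, eval_C]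
    ring
  -- The first sum loses its `k = 0` term, as the derivative of `q` of order `m + 1` is zero, and
  -- the second its `k = m + 1` term, of weight zero.
  rw [hL, Finset.sum_range_succ', Finset.sum_range_succ (n := m + 1)]
  simp only [Nat.sub_zero, hlast, eval_zero, mul_zero, add_zero, Nat.sub_self, Nat.cast_zero,
    zero_mul]
  rw [apolar, ← Finset.sum_add_distrib]
  refine Finset.sum_congr rfl fun k hk ↦ ?_
  have hk' : k ≤ m := by simpa [Nat.lt_succ_iff] using hk
  rw [iterate_derivative_sub, iterate_derivative_C_mul, iterate_derivative_X_sub_C_mul,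
    show m + 1 - (k + 1) = m - k by omega]
  have hk1 : (k : ℂ) * (derivative^[k - 1] (derivative g)).eval 0 =
      k * (derivative^[k] g).eval 0 := by
    cases k with
    | zero => simp
    | succ k => simp [Function.iterate_succ_apply]
  simp only [eval_sub, eval_add, eval_mul, eval_X, eval_C, hk1,
    ← Function.iterate_succ_apply derivative k g]
  rw [Nat.cast_sub (by omega)]
  push_cast
  ring

theorem natDegree_polarDerivative_le {m : ℕ} {g : ℂ[X]} (hg : g.natDegree ≤ m + 1) (v : ℂ) :
    (C ((m + 1 : ℕ) : ℂ) * g - (X - C v) * derivative g).natDegree ≤ m := by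
  rw [natDegree_le_iff_coeff_eq_zero]
  intro k hk
  obtain ⟨j, rfl⟩ : ∃ j, k = j + 1 := ⟨k - 1, by omega⟩
  have h2 : g.coeff (j + 1 + 1) = 0 := coeff_eq_zero_of_natDegree_lt (by omega)
  rw [coeff_sub, coeff_C_mul, sub_mul, coeff_sub, coeff_X_mul, coeff_C_mul, coeff_derivative,
    coeff_derivative, h2]
  rcases eq_or_ne j m with rfl | hj
  · push_cast; ring
  · rw [coeff_eq_zero_of_natDegree_lt (show g.natDegree < j + 1 by omega)]
    ring

/-- **Grace's theorem** for a disc, in product form. -/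
theorem apolar_prod_ne_zero {r : ℝ} (hr : 0 ≤ r) (s : Multiset ℂ) :
    (∀ v ∈ s, ‖v‖ ≤ r) → ∀ g : ℂ[X], g.natDegree ≤ s.card →
      (∀ w, ‖w‖ ≤ r → g.eval w ≠ 0) → apolar s.card g (s.map fun v ↦ X - C v).prod ≠ 0 := by
  induction s using Multiset.induction with
  | empty =>
    intro _ g _ hg
    simpa [apolar] using hg 0 (by simpa using hr)
  | cons v s ih =>
    intro hs g hdeg hg
    rw [Multiset.card_cons] at hdeg ⊢
    have hv := hs v (Multiset.mem_cons_self v s)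
    rw [Multiset.map_cons, Multiset.prod_cons,
      apolar_X_sub_C_mul g (natDegree_multiset_prod_X_sub_C_eq_card s).le v]
    exact ih (fun w hw ↦ hs w (Multiset.mem_cons_of_mem hw)) _
      (natDegree_polarDerivative_le hdeg v)
      fun z hz ↦ polarDerivative_eval_ne_zero (Nat.succ_pos _) hdeg hg hv hz

/-- **Grace's theorem** for a disc. -/
theorem apolar_ne_zero {r : ℝ} (hr : 0 ≤ r) {g q : ℂ[X]} (hq : q ≠ 0)
    (hroots : ∀ v, q.eval v = 0 → ‖v‖ ≤ r) (hdeg : g.natDegree ≤ q.natDegree)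
    (hg : ∀ w, ‖w‖ ≤ r → g.eval w ≠ 0) : apolar q.natDegree g q ≠ 0 := by
  have hs := IsAlgClosed.splits q
  have hcard := hs.natDegree_eq_card_roots
  have hne := apolar_prod_ne_zero hr q.roots (fun v hv ↦ hroots v ((mem_roots hq).1 hv)) g
    (hcard ▸ hdeg) hg
  rw [← hcard] at hne
  have heq : apolar q.natDegree g q =
      q.leadingCoeff * apolar q.natDegree g (q.roots.map fun v ↦ X - C v).prod := by
    have : q = C q.leadingCoeff * (q.roots.map fun v ↦ X - C v).prod := hs.eq_prod_roots
    simp only [apolar, Finset.mul_sum]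
    refine Finset.sum_congr rfl fun k _ ↦ ?_
    conv_lhs => rw [this, natDegree_C_mul (leadingCoeff_ne_zero.2 hq),
      natDegree_multiset_prod_X_sub_C_eq_card, ← hcard]
    rw [iterate_derivative_C_mul, eval_mul, eval_C]
    ring
  rw [heq]
  exact mul_ne_zero (leadingCoeff_ne_zero.2 hq) hne

/-! ### Zeros of `f - tγ f'` near zeros of `f - γ f'` -/

/-- **Eneström–Kakeya theorem**: a polynomial with nondecreasing nonnegative coefficients has its
zeros in the closed unit disc. -/
theorem norm_le_one_of_sum_eq_zero {b : ℕ → ℝ} {m : ℕ} (h0 : 0 ≤ b 0) (hm : 0 < b m)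
    (hmono : ∀ j < m, b j ≤ b (j + 1)) {w : ℂ}
    (hw : ∑ j ∈ Finset.range (m + 1), (b j : ℂ) * w ^ j = 0) : ‖w‖ ≤ 1 := by
  by_contra! h1
  -- The left side is `b₀ + ∑ (bⱼ - bⱼ₋₁) wʲ` over `1 ≤ j ≤ i`; its coefficients are nonnegative
  -- with sum `bᵢ`, and `|w| > 1`.
  have key : ∀ i ≤ m, ‖(1 - w) * ∑ j ∈ Finset.range (i + 1), (b j : ℂ) * w ^ j +
      b i * w ^ (i + 1)‖ ≤ b i * ‖w‖ ^ i := by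
    intro i
    induction i with
    | zero =>
      intro _
      have : (1 - w) * ∑ j ∈ Finset.range (0 + 1), (b j : ℂ) * w ^ j + b 0 * w ^ (0 + 1) =
          b 0 := by simp; ring
      rw [this]
      simp [abs_of_nonneg h0]
    | succ i ih =>
      intro hi
      have hb := hmono i (by omega)
      have : (1 - w) * ∑ j ∈ Finset.range (i + 1 + 1), (b j : ℂ) * w ^ j +
          b (i + 1) * w ^ (i + 1 + 1) =
          ((1 - w) * ∑ j ∈ Finset.range (i + 1), (b j : ℂ) * w ^ j + b i * w ^ (i + 1)) +
          ((b (i + 1) - b i : ℝ) : ℂ) * w ^ (i + 1) := by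
        rw [Finset.sum_range_succ]
        push_cast
        ring
      rw [this]
      refine (norm_add_le _ _).trans ?_
      rw [norm_mul, norm_pow, Complex.norm_real, Real.norm_of_nonneg (sub_nonneg.2 hb)]
      have h2 := ih (by omega)
      have hbi : 0 ≤ b i := by
        by_contra! hneg
        have := (norm_nonneg _).trans h2
        exact absurd this (not_le.2 (mul_neg_of_neg_of_pos hneg (by positivity)))
      have h3 : b i * ‖w‖ ^ i ≤ b i * ‖w‖ ^ (i + 1) :=
        mul_le_mul_of_nonneg_left (pow_le_pow_right₀ h1.le (by omega)) hbi
      nlinarith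
  have h2 := key m le_rfl
  rw [hw, mul_zero, zero_add, norm_mul, norm_pow, Complex.norm_real, Real.norm_of_nonneg hm.le]
    at h2
  have h3 := le_of_mul_le_mul_left h2 hm
  have h4 : ‖w‖ ^ m < ‖w‖ ^ (m + 1) := pow_lt_pow_right₀ h1 (by omega)
  linarith

theorem eval_zero_iterate_derivative (q : ℂ[X]) (j : ℕ) :
    (derivative^[j] q).eval 0 = (j.factorial : ℂ) * q.coeff j := by
  rw [← coeff_zero_eq_eval_zero, coeff_iterate_derivative, zero_add, Nat.descFactorial_self,
    nsmul_eq_mul]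

/-- The coefficients of `(1 - t z) / (1 - z)`, truncated. -/
theorem sum_iterate_derivative_sub (f : ℂ[X]) (γ t : ℂ) (m : ℕ) :
    ∑ k ∈ Finset.range (m + 1), C (if k = 0 then 1 else (1 - t) * γ ^ k) *
      derivative^[k] (f - C γ * derivative f) =
    f - C (t * γ) * derivative f - C ((1 - t) * γ ^ (m + 1)) * derivative^[m + 1] f := by
  induction m with
  | zero =>
    simp
    ring
  | succ m ih =>
    rw [Finset.sum_range_succ, ih, if_neg (Nat.succ_ne_zero m), iterate_derivative_sub,
      iterate_derivative_C_mul, ← Function.iterate_succ_apply derivative (m + 1) f,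
      pow_succ γ (m + 1)]
    simp only [C_mul]
    ring

/-- Grace's theorem, applied to `f - γ f'` and a polynomial `q` built so that their apolar pairing
is `mᵐ (f - tγ f')(0) = 0`. -/
theorem exists_zero_near_of_eval_zero {f : ℂ[X]} {γ : ℂ} (hγ : γ ≠ 0) {t : ℝ} (ht0 : 0 ≤ t)
    (ht1 : t ≤ 1) (hm : 0 < f.natDegree)
    (h : (f - C (t * γ) * derivative f).eval 0 = 0) :
    ∃ y, (f - C γ * derivative f).eval y = 0 ∧ ‖y‖ ≤ f.natDegree * ‖γ‖ := by
  by_contra! hne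
  set m := f.natDegree with hmdef
  set g := f - C γ * derivative f with hgdef
  have hm' : (m : ℂ) ≠ 0 := by exact_mod_cast hm.ne'
  -- The factorial cancels the one from differentiating `q`. Scaling by `m` is what makes `b`
  -- monotone, since `mʲ/j!` does not decrease up to `j = m`; the price is the factor `m` in `δ` and
  -- hence in the radius.
  let b : ℕ → ℝ := fun j ↦ (if j = m then 1 else 1 - t) * (m ^ j / j.factorial)
  let δ : ℂ := -(m * γ)
  have hδ : δ ≠ 0 := neg_ne_zero.2 (mul_ne_zero hm' hγ)
  let q : ℂ[X] := ∑ j ∈ Finset.range (m + 1), C ((b j : ℂ) * δ ^ (m - j)) * X ^ j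
  have hcoeff : ∀ j ≤ m, q.coeff j = (b j : ℂ) * δ ^ (m - j) := by
    intro j hj
    simp only [q, finsetSum_coeff, coeff_C_mul_X_pow]
    rw [Finset.sum_ite_eq, if_pos (Finset.mem_range.2 (by omega))]
  have hbm : 0 < b m := by
    simp only [b, if_true, one_mul]
    positivity
  have hlead : q.coeff m ≠ 0 := by
    rw [hcoeff m le_rfl, Nat.sub_self, pow_zero, mul_one]
    exact_mod_cast hbm.ne'
  have hqdeg : q.natDegree = m :=
    le_antisymm (natDegree_sum_le_of_forall_le _ _ fun j hj ↦ (natDegree_C_mul_X_pow_le _ _).trans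
      (by simpa [Nat.lt_succ_iff] using hj)) (le_natDegree_of_ne_zero hlead)
  have hq0 : q ≠ 0 := by rintro h0; simp [h0] at hlead
  have hmono : ∀ j < m, b j ≤ b (j + 1) := by
    intro j hj
    have h1 : (m : ℝ) ^ j / j.factorial ≤ m ^ (j + 1) / (j + 1).factorial := by
      rw [Nat.factorial_succ, div_le_div_iff₀ (by positivity) (by positivity)]
      have : ((j + 1 : ℕ) : ℝ) ≤ m := by exact_mod_cast hj
      push_cast at this ⊢
      have h3 : 0 ≤ (m : ℝ) ^ j * j.factorial := by positivity
      rw [pow_succ]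
      nlinarith
    have h2 : (if j = m then 1 else 1 - t) ≤ (if j + 1 = m then 1 else 1 - t) := by
      rw [if_neg hj.ne]
      split_ifs <;> linarith
    refine mul_le_mul h2 h1 (by positivity) ?_
    split_ifs <;> linarith
  have hqroots : ∀ v, q.eval v = 0 → ‖v‖ ≤ m * ‖γ‖ := by
    intro v hv
    have hw : ∑ j ∈ Finset.range (m + 1), (b j : ℂ) * (v / δ) ^ j = 0 := by
      have : q.eval v = δ ^ m * ∑ j ∈ Finset.range (m + 1), (b j : ℂ) * (v / δ) ^ j := by
        rw [Finset.mul_sum]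
        simp only [q, eval_finsetSum, eval_mul, eval_C, eval_pow, eval_X]
        refine Finset.sum_congr rfl fun j hj ↦ ?_
        have hj' : j ≤ m := by simpa [Nat.lt_succ_iff] using hj
        rw [div_pow, pow_sub₀ δ hδ hj']
        field_simp
      rw [this] at hv
      exact (mul_eq_zero.1 hv).resolve_left (pow_ne_zero _ hδ)
    have hb0 : 0 ≤ b 0 := by
      simp only [b, if_neg hm.ne]
      have : 0 ≤ 1 - t := by linarith
      positivity
    have := norm_le_one_of_sum_eq_zero hb0 hbm hmono hw
    rw [norm_div, div_le_one (norm_pos_iff.2 hδ)] at this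
    simpa [δ] using this
  have hgdeg : g.natDegree ≤ q.natDegree := by
    rw [hqdeg]
    refine (natDegree_sub_le _ _).trans (max_le le_rfl ?_)
    exact (natDegree_C_mul_le _ _).trans ((natDegree_derivative_le f).trans (Nat.sub_le _ _))
  have hap := apolar_ne_zero (r := m * ‖γ‖) (by positivity) hq0 hqroots hgdeg
    fun w hw h0 ↦ absurd hw (not_le.2 (hne w h0))
  apply hap
  rw [hqdeg, apolar]
  have hsum := congrArg (eval 0) (sum_iterate_derivative_sub f γ t m)
  -- The remainder of the truncated series contains a derivative of `f` of order `m + 1`, which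
  -- vanishes.
  rw [iterate_derivative_eq_zero (Nat.lt_succ_self m), mul_zero, sub_zero, h, eval_finsetSum]
    at hsum
  refine Eq.trans ?_ ((congrArg ((m : ℂ) ^ m * ·) hsum).trans (mul_zero _))
  rw [Finset.mul_sum]
  refine Finset.sum_congr rfl fun k hk ↦ ?_
  have hk' : k ≤ m := by simpa [Nat.lt_succ_iff] using hk
  rw [eval_zero_iterate_derivative q, hcoeff _ (Nat.sub_le _ _), Nat.sub_sub_self hk', eval_mul,
    eval_C]
  have hfac : ((m - k).factorial : ℂ) ≠ 0 := by exact_mod_cast Nat.factorial_ne_zero _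
  have hb : ((m - k).factorial : ℂ) * (b (m - k) : ℂ) =
      (if k = 0 then 1 else 1 - t) * (m : ℂ) ^ (m - k) := by
    have : m - k = m ↔ k = 0 := by omega
    simp only [b, this]
    split_ifs <;> push_cast <;> field_simp
  have hpow : (m : ℂ) ^ m = (m : ℂ) ^ (m - k) * m ^ k := by rw [← pow_add, Nat.sub_add_cancel hk']
  have hsign : (-1 : ℂ) ^ k * δ ^ k = (m : ℂ) ^ k * γ ^ k := by
    rw [← mul_pow, ← mul_pow]
    simp [δ]
  have hif : (if k = 0 then (1 : ℂ) else (1 - t) * γ ^ k) = (if k = 0 then 1 else 1 - t) * γ ^ k := by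
    split_ifs with h0 <;> simp [h0]
  rw [hif, hpow]
  linear_combination (eval 0 (derivative^[k] g)) * ((-1) ^ k * δ ^ k * hb +
    ((if k = 0 then 1 else 1 - t : ℝ) : ℂ) * (m : ℂ) ^ (m - k) * hsign)

/-- A zero of `f - t γ f'` with `0 ≤ t ≤ 1` is close to a root of `f - γ f'`. -/
theorem exists_zero_near_of_sub_derivative {f : ℂ[X]} (γ : ℂ) {t : ℝ} (ht0 : 0 ≤ t)
    (ht1 : t ≤ 1) (hm : 0 < f.natDegree) {z : ℂ}
    (h : (f - C (t * γ) * derivative f).eval z = 0) :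
    ∃ y, (f - C γ * derivative f).eval y = 0 ∧ ‖z - y‖ ≤ f.natDegree * ‖γ‖ := by
  rcases eq_or_ne γ 0 with rfl | hγ
  · exact ⟨z, by simpa using h, by simp⟩
  have hcomp : ∀ c : ℂ, (f.comp (X + C z)) - C c * derivative (f.comp (X + C z)) =
      (f - C c * derivative f).comp (X + C z) := by
    intro c
    simp [derivative_comp]
  have hdeg : (f.comp (X + C z)).natDegree = f.natDegree := by
    rw [natDegree_comp, natDegree_X_add_C, mul_one]
  obtain ⟨y, hy, hyr⟩ := exists_zero_near_of_eval_zero (f := f.comp (X + C z)) hγ ht0 ht1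
    (hdeg ▸ hm) (by
      rw [hcomp, eval_comp]
      simpa using h)
  refine ⟨y + z, ?_, ?_⟩
  · rw [hcomp, eval_comp] at hy
    simpa using hy
  · rw [hdeg] at hyr
    rwa [sub_add_cancel_right, norm_neg]

/-! ### Root counts along a path of polynomials -/

theorem countP_eq_card_filter (s : Multiset ℂ) (U : Set ℂ) [DecidablePred (· ∈ U)] :
    s.countP (· ∈ U) = (Finset.univ.filter fun i : s.ToType ↦ i.1 ∈ U).card := by
  conv_lhs => rw [← s.map_univ_coe]
  rw [Multiset.countP_map]
  rfl

theorem exists_fin_enumeration (s : Multiset ℂ) {m : ℕ} (hm : s.card = m) :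
    ∃ y : Fin m → ℂ, s = (Finset.univ : Finset (Fin m)).val.map y := by
  subst hm
  refine ⟨fun i ↦ s.toList.get (i.cast (Multiset.length_toList s).symm), ?_⟩
  conv_lhs => rw [← s.coe_toList]
  rw [Fin.univ_val_map, Multiset.coe_eq_coe]
  refine List.Perm.of_eq (List.ext_get (by simp) ?_)
  intro i h1 h2
  simp

/-- The parameters for which at least `k` roots of a polynomial, depending continuously on the
parameter, lie in a closed set form a closed set. -/
theorem isClosed_le_countP_roots {p : ℝ → ℂ[X]} {m : ℕ} {c : ℂ} (hc : c ≠ 0)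
    (hdeg : ∀ t, (p t).natDegree = m) (hlead : ∀ t, (p t).leadingCoeff = c)
    (hcont : ∀ z, Continuous fun t ↦ (p t).eval z) {K U : Set ℂ} [DecidablePred (· ∈ U)]
    (hK : IsCompact K) (hU : IsClosed U)
    (hroots : ∀ t ∈ Set.Icc (0 : ℝ) 1, ∀ z ∈ (p t).roots, z ∈ K) (k : ℕ) :
    IsClosed {t | t ∈ Set.Icc (0 : ℝ) 1 ∧ k ≤ (p t).roots.countP (· ∈ U)} := by
  -- Pairs of a parameter and an ordering of its roots in which the indices in `S` land in `U`. This
  -- set is compact, so its projection to the parameter is closed.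
  let E : Finset (Fin m) → Set (ℝ × (Fin m → ℂ)) := fun S ↦
    (Set.Icc (0 : ℝ) 1 ×ˢ Set.univ.pi fun _ ↦ K) ∩
      ((⋂ i ∈ S, {q | q.2 i ∈ U}) ∩ ⋂ z : ℂ, {q | c * ∏ i, (z - q.2 i) = (p q.1).eval z})
  have hE : ∀ S, IsClosed (Prod.fst '' E S) := by
    intro S
    refine IsCompact.isClosed (IsCompact.image ?_ continuous_fst)
    refine (isCompact_Icc.prod (isCompact_univ_pi fun _ ↦ hK)).inter_right (IsClosed.inter ?_ ?_)
    · exact isClosed_biInter fun i _ ↦ hU.preimage ((continuous_apply i).comp continuous_snd)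
    · refine isClosed_iInter fun z ↦ isClosed_eq ?_ ((hcont z).comp continuous_fst)
      fun_prop
  have hset : {t | t ∈ Set.Icc (0 : ℝ) 1 ∧ k ≤ (p t).roots.countP (· ∈ U)} =
      ⋃ S ∈ Finset.univ.powersetCard k, Prod.fst '' E S := by
    ext t
    simp only [Set.mem_ofPred_eq, Set.mem_iUnion, Finset.mem_powersetCard, Finset.subset_univ,
      true_and, exists_prop]
    constructor
    · rintro ⟨ht, hk⟩
      have hs := IsAlgClosed.splits (p t)
      obtain ⟨y, hy⟩ := exists_fin_enumeration (p t).roots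
        (hs.natDegree_eq_card_roots.symm.trans (hdeg t))
      rw [hy, Multiset.countP_map] at hk
      obtain ⟨S, hS, hSk⟩ := Finset.exists_subset_card_eq
        (s := Finset.univ.filter fun i ↦ y i ∈ U) hk
      refine ⟨S, hSk, ⟨t, y⟩, ⟨⟨ht, fun i _ ↦ hroots t ht _ ?_⟩, ?_, ?_⟩, rfl⟩
      · rw [hy]
        exact Multiset.mem_map_of_mem y (Finset.mem_univ_val i)
      · exact Set.mem_iInter₂.2 fun i hi ↦ (Finset.mem_filter.1 (hS hi)).2
      · refine Set.mem_iInter.2 fun z ↦ ?_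
        rw [Set.mem_ofPred_eq, hs.eval_eq_prod_roots, hlead, hy, Multiset.map_map]
        rfl
    · rintro ⟨S, hSk, ⟨t, y⟩, ⟨⟨ht, -⟩, hyU, hyp⟩, rfl⟩
      refine ⟨ht, ?_⟩
      have hp : p t = C c * ((Finset.univ.val.map y).map fun a ↦ X - C a).prod := by
        refine Polynomial.funext fun z ↦ ?_
        rw [← Set.mem_iInter.1 hyp z, eval_mul, eval_C, eval_multiset_prod, Multiset.map_map,
          Multiset.map_map]
        simp only [Function.comp_def, eval_sub, eval_X, eval_C]
        rfl
      dsimp only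
      rw [hp, roots_C_mul _ hc, roots_multiset_prod_X_sub_C, Multiset.countP_map, ← hSk]
      exact Finset.card_le_card (t := Finset.univ.filter fun i ↦ y i ∈ U) fun i hi ↦
        Finset.mem_filter.2 ⟨Finset.mem_univ i, Set.mem_iInter₂.1 hyU i hi⟩
  rw [hset]
  exact isClosed_biUnion_finset fun S _ ↦ hE S

/-- If the roots stay in the union of two disjoint compact sets, then none leaves either of
them. -/
theorem countP_roots_le {p : ℝ → ℂ[X]} {m : ℕ} {c : ℂ} (hc : c ≠ 0)
    (hdeg : ∀ t, (p t).natDegree = m) (hlead : ∀ t, (p t).leadingCoeff = c)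
    (hcont : ∀ z, Continuous fun t ↦ (p t).eval z) {U V : Set ℂ} [DecidablePred (· ∈ U)]
    (hU : IsCompact U) (hV : IsCompact V) (hUV : Disjoint U V)
    (hroots : ∀ t ∈ Set.Icc (0 : ℝ) 1, ∀ z ∈ (p t).roots, z ∈ U ∪ V) :
    (p 0).roots.countP (· ∈ U) ≤ (p 1).roots.countP (· ∈ U) := by
  classical
  have hadd : ∀ t ∈ Set.Icc (0 : ℝ) 1,
      (p t).roots.countP (· ∈ U) + (p t).roots.countP (· ∈ V) = m := by
    intro t ht
    have h1 : (p t).roots.countP (· ∈ V) = (p t).roots.countP (fun z ↦ ¬ z ∈ U) := by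
      refine Multiset.countP_congr rfl fun z hz ↦ ?_
      refine propext ⟨fun h ↦ hUV.notMem_of_mem_right h, fun h ↦ (hroots t ht z hz).resolve_left h⟩
    rw [h1, ← Multiset.card_eq_countP_add_countP,
      ← (IsAlgClosed.splits (p t)).natDegree_eq_card_roots, hdeg]
  by_contra! hlt
  have h0 : (0 : ℝ) ∈ Set.Icc (0 : ℝ) 1 := by simp
  have h1 : (1 : ℝ) ∈ Set.Icc (0 : ℝ) 1 := by simp
  have hclU := isClosed_le_countP_roots hc hdeg hlead hcont (hU.union hV) hU.isClosed hroots
    ((p 0).roots.countP (· ∈ U))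
  have hclV := isClosed_le_countP_roots hc hdeg hlead hcont (hU.union hV) hV.isClosed hroots
    ((p 0).roots.countP (· ∈ V) + 1)
  -- If `U` lost a root, "at least the initial count in `U`" and "more than the initial count in
  -- `V`" would be two nonempty closed conditions covering `[0, 1]`; they exclude each other because
  -- the counts add up to `m`.
  obtain ⟨t, -, ⟨ht, h2⟩, -, h3⟩ := isPreconnected_closed_iff.1
    (isPreconnected_Icc (a := (0 : ℝ)) (b := 1)) _ _ hclU hclV
    (by
      intro t ht
      have e0 := hadd 0 h0
      have et := hadd t ht
      rcases le_or_gt ((p 0).roots.countP (· ∈ U)) ((p t).roots.countP (· ∈ U)) with h | h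
      · exact Or.inl ⟨ht, h⟩
      · exact Or.inr ⟨ht, by omega⟩)
    ⟨0, h0, h0, le_rfl⟩
    ⟨1, h1, h1, by have e0 := hadd 0 h0; have e1 := hadd 1 h1; omega⟩
  have e0 := hadd 0 h0
  have et := hadd t ht
  omega

/-! ### Matching the roots -/

/-- Every finite set of points can be enlarged to one that is isolated at scale `d`, in at most as
many steps as there are further points. -/
theorem exists_isolated_superset {ι : Type*} [Fintype ι] (x : ι → ℂ) {d : ℝ} (hd : 0 ≤ d)
    (A : Finset ι) :
    ∃ S : Finset ι, A ⊆ S ∧ (∀ i ∈ S, ∀ j, ‖x i - x j‖ ≤ d → j ∈ S) ∧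
      ∀ i ∈ S, ∃ a ∈ A, ‖x a - x i‖ ≤ (Fintype.card ι - A.card : ℝ) * d := by
  classical
  induction hk : Fintype.card ι - A.card generalizing A with
  | zero =>
    have hA : A = Finset.univ := by
      rw [← Finset.card_eq_iff_eq_univ]
      have := A.card_le_univ
      omega
    exact ⟨A, subset_rfl, fun i _ j _ ↦ by simp [hA], fun i hi ↦ ⟨i, hi, by simp [hA]⟩⟩
  | succ k ih =>
    by_cases hcl : ∀ i ∈ A, ∀ j, ‖x i - x j‖ ≤ d → j ∈ A
    · refine ⟨A, subset_rfl, hcl, fun i hi ↦ ⟨i, hi, ?_⟩⟩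
      have : (A.card : ℝ) ≤ Fintype.card ι := by exact_mod_cast A.card_le_univ
      rw [sub_self, norm_zero]
      exact mul_nonneg (by linarith) hd
    · push Not at hcl
      obtain ⟨i₀, hi₀, j, hj, hjA⟩ := hcl
      have hcard := Finset.card_insert_of_notMem hjA
      obtain ⟨S, hAS, hS, hnear⟩ := ih (insert j A) (by omega)
      refine ⟨S, (Finset.subset_insert j A).trans hAS, hS, fun i hi ↦ ?_⟩
      obtain ⟨a, ha, hai⟩ := hnear i hi
      rw [hcard] at hai
      push_cast at hai
      rcases Finset.mem_insert.1 ha with rfl | ha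
      · refine ⟨i₀, hi₀, ?_⟩
        have := norm_sub_le_norm_sub_add_norm_sub (x i₀) (x a) (x i)
        nlinarith
      · exact ⟨a, ha, by nlinarith⟩

/-- Along a path of polynomials whose roots stay near the initial ones, large sets of initial and
of final roots contain close points. -/
theorem exists_close_roots {p : ℝ → ℂ[X]} {m : ℕ} {c : ℂ} (hc : c ≠ 0)
    (hdeg : ∀ t, (p t).natDegree = m) (hlead : ∀ t, (p t).leadingCoeff = c)
    (hcont : ∀ z, Continuous fun t ↦ (p t).eval z) {r : ℝ} (hr : 0 ≤ r) {P Q : ℂ[X]}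
    (hP : p 0 = P) (hQ : p 1 = Q)
    (hroots : ∀ t ∈ Set.Icc (0 : ℝ) 1, ∀ z ∈ (p t).roots, ∃ x ∈ P.roots, ‖z - x‖ ≤ r)
    {A : Finset P.roots.ToType} {B : Finset Q.roots.ToType} (hAB : m < A.card + B.card) :
    ∃ a ∈ A, ∃ b ∈ B, ‖(a.1 : ℂ) - b.1‖ ≤ (2 * (m - A.card) + 1) * r := by
  classical
  subst hP hQ
  -- Isolation at scale `2r` makes the discs of radius `r` around `S` disjoint from those around its
  -- complement.
  obtain ⟨S, hAS, hS, hnear⟩ := exists_isolated_superset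
    (fun i : (p 0).roots.ToType ↦ (i.1 : ℂ)) (show 0 ≤ 2 * r by linarith) A
  let U : Finset (p 0).roots.ToType → Set ℂ := fun T ↦ ⋃ i ∈ T, Metric.closedBall (i.1 : ℂ) r
  have hUc : ∀ T, IsCompact (U T) := fun T ↦ T.isCompact_biUnion fun i _ ↦ isCompact_closedBall _ _
  have hmemU : ∀ {T z}, z ∈ U T ↔ ∃ i ∈ T, ‖z - i.1‖ ≤ r := by
    intro T z
    simp only [U, Set.mem_iUnion, Metric.mem_closedBall, dist_eq_norm, exists_prop]
  have hdisj : Disjoint (U S) (U Sᶜ) := by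
    rw [Set.disjoint_left]
    intro z hz hz'
    obtain ⟨i, hi, hiz⟩ := hmemU.1 hz
    obtain ⟨j, hj, hjz⟩ := hmemU.1 hz'
    refine (Finset.mem_compl.1 hj) (hS i hi j ?_)
    have := norm_sub_le_norm_sub_add_norm_sub (i.1 : ℂ) z j.1
    rw [norm_sub_rev (i.1 : ℂ) z] at this
    linarith
  have hcount := countP_roots_le hc hdeg hlead hcont (hUc S) (hUc Sᶜ) hdisj (by
    intro t ht z hz
    obtain ⟨x, hx, hxz⟩ := hroots t ht z hz
    let i : (p 0).roots.ToType := ⟨x, ⟨0, Multiset.count_pos.2 hx⟩⟩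
    by_cases hi : i ∈ S
    · exact Or.inl (hmemU.2 ⟨i, hi, hxz⟩)
    · exact Or.inr (hmemU.2 ⟨i, Finset.mem_compl.2 hi, hxz⟩))
  rw [countP_eq_card_filter, countP_eq_card_filter] at hcount
  have hcardA : A.card ≤ (Finset.univ.filter fun i : (p 0).roots.ToType ↦ i.1 ∈ U S).card :=
    Finset.card_le_card fun i hi ↦ Finset.mem_filter.2
      ⟨Finset.mem_univ i, hmemU.2 ⟨i, hAS hi, by simpa using hr⟩⟩
  have hcard : ∀ t, Fintype.card (p t).roots.ToType = m := fun t ↦ by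
    rw [Multiset.card_coe, ← (IsAlgClosed.splits (p t)).natDegree_eq_card_roots, hdeg]
  -- At least `|A|` of the `m` final roots lie in `U S`, and `|A| + |B| > m`.
  obtain ⟨b, hb⟩ : (B ∩ Finset.univ.filter fun i : (p 1).roots.ToType ↦ i.1 ∈ U S).Nonempty := by
    refine Finset.inter_nonempty_of_card_lt_card_add_card (Finset.subset_univ B)
      (Finset.subset_univ _) ?_
    rw [Finset.card_univ, hcard]
    omega
  rw [Finset.mem_inter, Finset.mem_filter] at hb
  obtain ⟨i, hi, hib⟩ := hmemU.1 hb.2.2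
  obtain ⟨a, ha, hai⟩ := hnear i hi
  refine ⟨a, ha, b, hb.1, ?_⟩
  rw [hcard] at hai
  have := norm_sub_le_norm_sub_add_norm_sub (a.1 : ℂ) i.1 b.1
  rw [norm_sub_rev (i.1 : ℂ) b.1] at this
  linarith

theorem degree_C_mul_derivative_lt {f : ℂ[X]} (hf : f ≠ 0) (c : ℂ) :
    (C c * derivative f).degree < f.degree :=
  (smul_eq_C_mul (p := derivative f) c ▸ degree_smul_le c _).trans_lt (degree_derivative_lt hf)

theorem degree_sub_C_mul_derivative (f : ℂ[X]) (c : ℂ) :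
    (f - C c * derivative f).degree = f.degree := by
  rcases eq_or_ne f 0 with rfl | hf
  · simp
  · exact degree_sub_eq_left_of_degree_lt (degree_C_mul_derivative_lt hf c)

theorem leadingCoeff_sub_C_mul_derivative {f : ℂ[X]} (hf : f ≠ 0) (c : ℂ) :
    (f - C c * derivative f).leadingCoeff = f.leadingCoeff :=
  leadingCoeff_sub_of_degree_lt (degree_C_mul_derivative_lt hf c)

/-- The elements of two multisets can be matched with all distances at most `R`. -/
def Matched (R : ℝ) (U V : Multiset ℂ) : Prop :=
  ∃ σ : U.ToType ≃ V.ToType, ∀ x : U.ToType, ‖(x.1 : ℂ) - (σ x).1‖ ≤ R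

theorem Matched.refl (U : Multiset ℂ) : Matched 0 U U :=
  ⟨Equiv.refl _, fun x ↦ by simp⟩

theorem Matched.trans {R R' : ℝ} {U V W : Multiset ℂ} (h : Matched R U V) (h' : Matched R' V W) :
    Matched (R + R') U W := by
  obtain ⟨σ, hσ⟩ := h
  obtain ⟨τ, hτ⟩ := h'
  exact ⟨σ.trans τ, fun x ↦ (norm_sub_le_norm_sub_add_norm_sub _ (σ x).1 _).trans
    (add_le_add (hσ x) (hτ (σ x)))⟩

theorem Matched.mono {R R' : ℝ} {U V : Multiset ℂ} (h : Matched R U V) (hR : R ≤ R') :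
    Matched R' U V :=
  h.imp fun _ hσ x ↦ (hσ x).trans hR

theorem Matched.dF_le {R : ℝ} {U V : Multiset ℂ} (h : Matched R U V) :
    dF U V ≤ ENNReal.ofReal R := by
  obtain ⟨σ, hσ⟩ := h
  refine iInf_le_of_le σ (iSup_le fun x ↦ ?_)
  rw [edist_dist, dist_eq_norm]
  exact ENNReal.ofReal_le_ofReal (hσ x)

/-- The roots of `f` and of `f - γ f'` can be matched. -/
theorem matched_roots_sub_C_mul_derivative {f : ℂ[X]} (hm : 0 < f.natDegree) (γ : ℂ) :
    Matched (f.natDegree * (f.natDegree * ‖γ‖)) f.roots (f - C γ * derivative f).roots := by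
  classical
  have hf : f ≠ 0 := by rintro rfl; simp at hm
  set g := f - C γ * derivative f with hg
  set m := f.natDegree with hmdef
  set r := (m : ℝ) * ‖γ‖ with hr
  have hr0 : 0 ≤ r := by positivity
  have hc := leadingCoeff_ne_zero.2 hf
  have hdeg : ∀ c : ℂ, (f - C c * derivative f).natDegree = m := fun c ↦
    natDegree_eq_of_degree_eq (degree_sub_C_mul_derivative f c)
  have hg0 : g ≠ 0 := by
    rw [← leadingCoeff_ne_zero, hg, leadingCoeff_sub_C_mul_derivative hf]
    exact hc
  have hcardf : Fintype.card f.roots.ToType = m := by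
    rw [Multiset.card_coe, ← (IsAlgClosed.splits f).natDegree_eq_card_roots]
  have hcardg : Fintype.card g.roots.ToType = m := by
    rw [Multiset.card_coe, ← (IsAlgClosed.splits g).natDegree_eq_card_roots, hg, hdeg]
  have hcont : ∀ z, Continuous fun t : ℝ ↦ (f - C ((t : ℂ) * γ) * derivative f).eval z := by
    intro z
    simp only [eval_sub, eval_mul, eval_C]
    fun_prop
  have hnearf : ∀ t ∈ Set.Icc (0 : ℝ) 1, ∀ z ∈ (f - C ((t : ℂ) * γ) * derivative f).roots,
      ∃ x ∈ f.roots, ‖z - x‖ ≤ r := by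
    intro t ht z hz
    obtain ⟨x, hx, hzx⟩ := exists_root_near_of_sub_derivative hf (isRoot_of_mem_roots hz)
    refine ⟨x, hx, hzx.trans (mul_le_mul_of_nonneg_left ?_ (Nat.cast_nonneg _))⟩
    rw [norm_mul, Complex.norm_real, Real.norm_of_nonneg ht.1]
    exact mul_le_of_le_one_left (norm_nonneg γ) ht.2
  have hnearg : ∀ t ∈ Set.Icc (0 : ℝ) 1, ∀ z ∈ (f - C ((t : ℂ) * γ) * derivative f).roots,
      ∃ x ∈ g.roots, ‖z - x‖ ≤ r := by
    intro t ht z hz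
    obtain ⟨y, hy, hzy⟩ := exists_zero_near_of_sub_derivative γ ht.1 ht.2 hm
      (isRoot_of_mem_roots hz)
    exact ⟨y, (mem_roots hg0).2 hy, hzy⟩
  have hone : ∀ t ∈ Set.Icc (0 : ℝ) 1, 1 - t ∈ Set.Icc (0 : ℝ) 1 := fun t ht ↦
    ⟨by linarith [ht.2], by linarith [ht.1]⟩
  let nbr : f.roots.ToType → Finset g.roots.ToType := fun x ↦
    Finset.univ.filter fun y ↦ ‖(x.1 : ℂ) - y.1‖ ≤ m * r
  have hall : ∀ A : Finset f.roots.ToType, A.card ≤ (A.biUnion nbr).card := by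
    intro A
    by_contra! hlt
    set B := (A.biUnion nbr)ᶜ with hB
    have hBcard : B.card = m - (A.biUnion nbr).card := by rw [hB, Finset.card_compl, hcardg]
    have hAm : A.card ≤ m := hcardf ▸ A.card_le_univ
    have hsum : m < A.card + B.card := by omega
    have hfar : ∀ a ∈ A, ∀ b ∈ B, (m : ℝ) * r < ‖(a.1 : ℂ) - b.1‖ := by
      intro a ha b hb
      by_contra! hle
      exact Finset.mem_compl.1 hb (Finset.mem_biUnion.2
        ⟨a, ha, Finset.mem_filter.2 ⟨Finset.mem_univ b, hle⟩⟩)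
    have hcast : (m : ℝ) + 1 ≤ A.card + B.card := by exact_mod_cast hsum
    -- The constant `2(m - |A|) + 1` is at most `m` exactly when `2|A| ≥ m + 1`. Otherwise `|B| > m
    -- - |A|` makes the same constant for `B` at most `m`, and the reversed path is used.
    rcases le_or_gt (m + 1) (2 * A.card) with h | h
    · obtain ⟨a, ha, b, hb, hab⟩ := exists_close_roots
        (p := fun t : ℝ ↦ f - C ((t : ℂ) * γ) * derivative f) hc (fun t ↦ hdeg _)
        (fun t ↦ leadingCoeff_sub_C_mul_derivative hf _) hcont hr0 (P := f) (Q := g)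
        (by simp) (by simp [hg]) hnearf hsum
      have h' : (m : ℝ) + 1 ≤ 2 * A.card := by exact_mod_cast h
      exact absurd (hab.trans (mul_le_mul_of_nonneg_right (by linarith) hr0))
        (not_le.2 (hfar a ha b hb))
    · obtain ⟨b, hb, a, ha, hab⟩ := exists_close_roots
        (p := fun t : ℝ ↦ f - C (((1 - t : ℝ) : ℂ) * γ) * derivative f) hc (fun t ↦ hdeg _)
        (fun t ↦ leadingCoeff_sub_C_mul_derivative hf _)
        (fun z ↦ (hcont z).comp (continuous_const.sub continuous_id)) hr0 (P := g) (Q := f)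
        (by simp [hg]) (by simp) (fun t ht ↦ hnearg _ (hone t ht)) (A := B) (B := A) (by omega)
      have h' : 2 * (A.card : ℝ) < m + 1 := by exact_mod_cast h
      rw [norm_sub_rev] at hab
      exact absurd (hab.trans (mul_le_mul_of_nonneg_right (by linarith) hr0))
        (not_le.2 (hfar a ha b hb))
  obtain ⟨σ, hσ, hσn⟩ := (Finset.all_card_le_biUnion_card_iff_exists_injective nbr).1 hall
  exact ⟨Equiv.ofBijective σ ((Fintype.bijective_iff_injective_and_card σ).2
    ⟨hσ, hcardf.trans hcardg.symm⟩), fun x ↦ (Finset.mem_filter.1 (hσn x)).2⟩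

/-! ### Bounds for the zero sets -/

/-- Every zero of `g` is within distance `R` of a zero of `f`. -/
def ZerosNear (R : ℝ) (f g : ℂ[X]) : Prop :=
  ∀ z, g.IsRoot z → ∃ x, f.IsRoot x ∧ ‖z - x‖ ≤ R

theorem ZerosNear.trans {R R' : ℝ} {f g h : ℂ[X]} (H : ZerosNear R f g) (H' : ZerosNear R' g h) :
    ZerosNear (R + R') f h := by
  intro z hz
  obtain ⟨y, hy, hzy⟩ := H' z hz
  obtain ⟨x, hx, hyx⟩ := H y hy
  refine ⟨x, hx, (norm_sub_le_norm_sub_add_norm_sub z y x).trans ?_⟩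
  linarith

theorem ZerosNear.mono {R R' : ℝ} {f g : ℂ[X]} (h : ZerosNear R f g) (hR : R ≤ R') :
    ZerosNear R' f g :=
  fun z hz ↦ (h z hz).imp fun _ hx ↦ ⟨hx.1, hx.2.trans hR⟩

theorem zerosNear_self (f : ℂ[X]) : ZerosNear 0 f f :=
  fun z hz ↦ ⟨z, hz, by simp⟩

/-- Equality of degrees rules out the infinite value: if `g` has no zeros, both polynomials are
nonzero constants. -/
theorem ZerosNear.dh_le {R : ℝ} {f g : ℂ[X]} (h : ZerosNear R f g) (hdeg : f.degree = g.degree) :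
    dh (Z f) (Z g) ≤ ENNReal.ofReal R := by
  rw [dh]
  split_ifs with h1 h2 h3
  · exact zero_le
  · exfalso
    obtain ⟨x, hx⟩ := Set.nonempty_iff_ne_empty.2 h2
    have hg : g.degree = 0 := by
      by_contra h0
      obtain ⟨y, hy⟩ := IsAlgClosed.exists_root g h0
      have : y ∈ Z g := hy
      rw [h1] at this
      exact this
    rw [hg] at hdeg
    have hx' : f.eval x = 0 := hx
    rw [eq_C_of_degree_eq_zero hdeg, eval_C] at hx'
    rw [eq_C_of_degree_eq_zero hdeg, hx', C_0, degree_zero] at hdeg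
    exact absurd hdeg (by simp)
  · exact zero_le
  · refine iSup₂_le fun y hy ↦ ?_
    obtain ⟨x, hx, hyx⟩ := h y hy
    rw [dm, if_neg (by simp)]
    refine iInf₂_le_of_le x hx (iInf₂_le_of_le y rfl ?_)
    rw [edist_comm, edist_dist, dist_eq_norm]
    exact ENNReal.ofReal_le_ofReal hyx

theorem zerosNear_sub_C_mul_derivative {f : ℂ[X]} {n : ℕ} (hn : f.natDegree ≤ n) (γ : ℂ) :
    ZerosNear (n * ‖γ‖) f (f - C γ * derivative f) := by
  rcases eq_or_ne f 0 with rfl | hf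
  · exact fun z _ ↦ ⟨z, by simp, by simpa using (by positivity)⟩
  · intro z hz
    obtain ⟨x, hx, hzx⟩ := exists_root_near_of_sub_derivative hf hz
    exact ⟨x, isRoot_of_mem_roots hx, hzx.trans (by gcongr)⟩

theorem sub_C_mul_derivative_zerosNear {f : ℂ[X]} {n : ℕ} (hn : f.natDegree ≤ n) (γ : ℂ) :
    ZerosNear (n * ‖γ‖) (f - C γ * derivative f) f := by
  rcases Nat.eq_zero_or_pos f.natDegree with h0 | hm
  · rw [eq_C_of_natDegree_eq_zero h0, derivative_C, mul_zero, sub_zero]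
    exact (zerosNear_self _).mono (by positivity)
  · intro z hz
    -- At `t = 0` the polynomial `f - tγ f'` is `f` itself.
    obtain ⟨y, hy, hzy⟩ := exists_zero_near_of_sub_derivative γ le_rfl zero_le_one hm
      (z := z) (by simpa using hz)
    exact ⟨y, hy, hzy.trans (by gcongr)⟩

/-! ### Factorization of the operator and conclusion -/

/-- The action of a polynomial in the differentiation operator. -/
theorem coe_diffOp {n : ℕ} (a : Fin (n + 1) → ℂ) (f : Pn n) :
    (diffOp a f : ℂ[X]) =
      aeval (derivative : ℂ[X] →ₗ[ℂ] ℂ[X]) (∑ k : Fin (n + 1), C (a k) * X ^ (k : ℕ)) f := by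
  have hpow : ∀ k : ℕ, ∀ f : Pn n, ((D n ^ k) f : ℂ[X]) =
      ((derivative : ℂ[X] →ₗ[ℂ] ℂ[X]) ^ k : Module.End ℂ ℂ[X]) f := by
    intro k
    induction k with
    | zero => intro f; simp
    | succ k ih =>
      intro f
      rw [pow_succ, pow_succ, Module.End.mul_apply, Module.End.mul_apply, ih]
      rfl
  simp [diffOp, LinearMap.sum_apply, hpow, Algebra.algebraMap_eq_smul_one]

/-- The reversed symbol factors over the roots of the symbol. -/
theorem reversed_symbol_eq {n : ℕ} (a : Fin (n + 1) → ℂ) (γ : Fin n → ℂ) (ha : a 0 ≠ 0)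
    (hγ : (symbol a).roots = (Finset.univ : Finset (Fin n)).val.map γ) :
    ∑ k : Fin (n + 1), C (a k) * X ^ (k : ℕ) = C (a 0) * ∏ j, (1 - C (γ j) * X) := by
  have hle : (symbol a).natDegree ≤ n :=
    natDegree_sum_le_of_forall_le _ _ fun k _ ↦
      (natDegree_C_mul_X_pow_le _ _).trans (Nat.sub_le _ _)
  have hcoeff : (symbol a).coeff n = a 0 := by
    rw [symbol, finsetSum_coeff, Finset.sum_eq_single 0]
    · simp
    · intro k _ hk
      have : (k : ℕ) ≠ 0 := fun h ↦ hk (Fin.ext h)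
      rw [coeff_C_mul_X_pow, if_neg (by omega)]
    · simp
  have hlead : (symbol a).leadingCoeff = a 0 := by
    rw [leadingCoeff, le_antisymm hle (le_natDegree_of_ne_zero (hcoeff ▸ ha)), hcoeff]
  have heval : ∀ w, (symbol a).eval w = a 0 * ∏ j, (w - γ j) := by
    intro w
    rw [(IsAlgClosed.splits (symbol a)).eval_eq_prod_roots, hlead, hγ, Multiset.map_map]
    rfl
  refine Polynomial.funext fun z ↦ ?_
  simp only [eval_finsetSum, eval_mul, eval_C, eval_pow, eval_X, eval_prod, eval_sub, eval_one]
  rcases eq_or_ne z 0 with rfl | hz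
  · simp [Fin.sum_univ_succ]
  -- Reversal of coefficients is `z ↦ zⁿ p(1/z)`, which turns each `w - γⱼ` into `1 - γⱼ z`.
  · have h1 := congrArg (z ^ n * ·) (heval z⁻¹)
    simp only [symbol, eval_finsetSum, eval_mul, eval_C, eval_pow, eval_X, Finset.mul_sum] at h1
    convert h1 using 1
    · refine Finset.sum_congr rfl fun k _ ↦ ?_
      have hk : (k : ℕ) ≤ n := Nat.lt_succ_iff.1 k.2
      rw [inv_pow, ← pow_sub_mul_pow z hk]
      field_simp
    · have : z ^ n = ∏ _j : Fin n, z := by simp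
      rw [mul_left_comm, this, ← Finset.prod_mul_distrib]
      congr 1
      refine Finset.prod_congr rfl fun j _ ↦ ?_
      field_simp

/-- Effect of a product of operators `1 - γ D` on degrees and zeros. -/
theorem aeval_prod_derivative {ι : Type*} (s : Finset ι) (γ : ι → ℂ) {n : ℕ} {f : ℂ[X]}
    (hn : f.natDegree ≤ n) {h : ℂ[X]}
    (hh : aeval (derivative : ℂ[X] →ₗ[ℂ] ℂ[X]) (∏ j ∈ s, (1 - C (γ j) * X)) f = h) :
    h.degree = f.degree ∧ ZerosNear (n * ∑ j ∈ s, ‖γ j‖) f h ∧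
      ZerosNear (n * ∑ j ∈ s, ‖γ j‖) h f ∧
      (0 < f.natDegree → Matched ((n : ℝ) ^ 2 * ∑ j ∈ s, ‖γ j‖) f.roots h.roots) := by
  classical
  induction s using Finset.induction generalizing h with
  | empty =>
    obtain rfl : f = h := by simpa using hh
    rw [Finset.sum_empty, mul_zero, mul_zero]
    exact ⟨rfl, zerosNear_self f, zerosNear_self f, fun _ ↦ Matched.refl _⟩
  | insert i s hi ih =>
    obtain ⟨hdeg, hfg, hgf, hmat⟩ := ih rfl
    set g := aeval (derivative : ℂ[X] →ₗ[ℂ] ℂ[X]) (∏ j ∈ s, (1 - C (γ j) * X)) f with hg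
    have hgn : g.natDegree = f.natDegree := natDegree_eq_of_degree_eq hdeg
    obtain rfl : h = g - C (γ i) * derivative g := by
      rw [← hh, Finset.prod_insert hi, map_mul, Module.End.mul_apply, ← hg]
      simp [Algebra.algebraMap_eq_smul_one, smul_eq_C_mul]
    rw [Finset.sum_insert hi, mul_add, mul_add, add_comm (_ * ‖γ i‖), add_comm (_ * ‖γ i‖)]
    refine ⟨(degree_sub_C_mul_derivative g _).trans hdeg,
      hfg.trans (zerosNear_sub_C_mul_derivative (hgn.le.trans hn) _),
      ?_, fun hf ↦ (hmat hf).trans ?_⟩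
    · rw [add_comm]
      exact (sub_C_mul_derivative_zerosNear (hgn.le.trans hn) _).trans hgf
    · refine (matched_roots_sub_C_mul_derivative (hgn ▸ hf) (γ i)).mono ?_
      rw [hgn, sq, mul_assoc]
      gcongr

end RootDistance

open RootDistance Polynomial in
theorem theorem9p4 (n : ℕ) (hn : 0 < n) (a : Fin (n + 1) → ℂ) (ha : a 0 ≠ 0)
    (γ : Fin n → ℂ)
    (hγ : (RootDistance.symbol a).roots = (Finset.univ : Finset (Fin n)).val.map γ) :
    Function.Bijective (RootDistance.diffOp a) ∧
    RootDistance.Kh (RootDistance.diffOp a) ≤ ENNReal.ofReal ((n : ℝ) * ∑ j, ‖γ j‖) ∧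
    RootDistance.KH (RootDistance.diffOp a) ≤ ENNReal.ofReal ((n : ℝ) * ∑ j, ‖γ j‖) ∧
    ∃ hT : RootDistance.PreservesDegree (RootDistance.diffOp a),
      RootDistance.KF (RootDistance.diffOp a) hT ≤
        ENNReal.ofReal ((n : ℝ) ^ 2 * ∑ j, ‖γ j‖) := by
  -- The nonzero scalar `a 0` affects neither degrees nor roots, so only the product of the factors
  -- `1 - γⱼ D` matters.
  have key : ∀ f : Pn n, ∃ h : ℂ[X], (diffOp a f : ℂ[X]) = C (a 0) * h ∧
      h.degree = (f : ℂ[X]).degree ∧ ZerosNear (n * ∑ j, ‖γ j‖) f h ∧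
      ZerosNear (n * ∑ j, ‖γ j‖) h f ∧ (0 < (f : ℂ[X]).natDegree →
        Matched ((n : ℝ) ^ 2 * ∑ j, ‖γ j‖) (f : ℂ[X]).roots h.roots) := by
    intro f
    refine ⟨aeval (derivative : ℂ[X] →ₗ[ℂ] ℂ[X]) (∏ j, (1 - C (γ j) * X)) f, ?_,
      aeval_prod_derivative _ γ (natDegree_le_iff_degree_le.2 (mem_degreeLE.1 f.2)) rfl⟩
    rw [coe_diffOp, reversed_symbol_eq a γ ha hγ, map_mul, Module.End.mul_apply, aeval_C,
      Module.algebraMap_end_apply, smul_eq_C_mul]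
  have hZ : ∀ h : ℂ[X], Z (C (a 0) * h) = Z h := by
    intro h
    ext z
    simp [Z, ha]
  have hT : PreservesDegree (diffOp a) := by
    intro f
    obtain ⟨h, hf, hdeg, -⟩ := key f
    rw [hf, degree_C_mul ha, hdeg]
  have hh : ∀ f : Pn n,
      dh (Z (f : ℂ[X])) (Z (diffOp a f : ℂ[X])) ≤ ENNReal.ofReal ((n : ℝ) * ∑ j, ‖γ j‖) := by
    intro f
    obtain ⟨h, hf, hdeg, hfh, -⟩ := key f
    rw [hf, hZ]
    exact hfh.dh_le hdeg.symm
  have hh' : ∀ f : Pn n,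
      dh (Z (diffOp a f : ℂ[X])) (Z (f : ℂ[X])) ≤ ENNReal.ofReal ((n : ℝ) * ∑ j, ‖γ j‖) := by
    intro f
    obtain ⟨h, hf, hdeg, -, hhf, -⟩ := key f
    rw [hf, hZ]
    exact hhf.dh_le hdeg
  have hinj : Function.Injective (diffOp a) := by
    rw [injective_iff_map_eq_zero]
    intro f hf
    have := hT f
    rw [hf, ZeroMemClass.coe_zero, degree_zero, eq_comm, degree_eq_bot] at this
    exact Subtype.ext this
  have hfin : FiniteDimensional ℂ (Pn n) := by
    have : Pn n = degreeLT ℂ (n + 1) := by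
      ext f
      rw [mem_degreeLE, mem_degreeLT]
      exact Order.lt_succ_iff.symm
    rw [this]
    exact Module.Finite.of_basis (degreeLT.basis ℂ (n + 1))
  refine ⟨⟨hinj, LinearMap.injective_iff_surjective.1 hinj⟩, iSup_le hh,
    iSup_le fun f ↦ max_le (hh f) (hh' f), hT, iSup₂_le fun f hf ↦ ?_⟩
  obtain ⟨h, hfh, -, -, -, hmat⟩ := key f
  rw [hfh, roots_C_mul _ ha]
  exact (hmat hf).dF_le
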